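/- Let $Q$ be a finitely generated, cancellative, torsion-free commutative semigroup with identity (written additively) which is pointed, i.e. has no units other than $0$. Let $M$ be the group generated by $Q$, let $M_{\mathbb R}=M\otimes_{\mathbb Z}\mathbb R$, and let $\sigma\subset M_{\mathbb R}$ be the convex cone generated by $Q$. Suppose that $Q$ is one-dimensional, i.e. $M$ has rank $1$. Then there is exactly one generator $w$ of the group $M$ that lies in $\sigma$, and for every prime $p$ and every field $k$ of characteristic $p$ (with no further restriction on $p$), $$\mathrm{HSL}\bigl(H^1_{\mathfrak m}(k[Q])\bigr)=\min\{e\in\mathbb N : p^e w\in Q\},$$ where in particular the set on the right is non-empty. Here $\mathbb N$ contains $0$; $k[Q]$ is the semigroup ring and $\mathfrak m$ is its ideal generated by all monomials $x^v$ with $v\in Q$ not a unit; $H^i_{\mathfrak m}$ is the $i$-th right derived functor of $\Gamma_{\mathfrak m}(N)=\{x\in N : \mathfrak m^n x=0\text{ for some }n\}$ on $R$-modules, $R=k[Q]$. The module $H^1_{\mathfrak m}(R)$ carries the natural Frobenius action $F$ induced by the Frobenius map of $R$: writing $F_*$ for restriction of scalars along the Frobenius map, $F$ is the unique additive map with $F(rx)=r^pF(x)$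 whose composite with the canonical map $F_*H^1_{\mathfrak m}(R)\to H^1_{\mathfrak m}(F_*R)$ is the map $H^1_{\mathfrak m}(R)\to H^1_{\mathfrak m}(F_*R)$ induced by the $R$-linear map $R\to F_*R$, $r\mapsto r^p$ (this $F$ exists and is unique). For a module $N$ with Frobenius action $\rho$, $\mathrm{HSL}(N)=\inf\{e\in\mathbb N : \rho^e(x)=0\text{ for all }x\in N\text{ with }\rho^{e'}(x)=0\text{ for some }e'\in\mathbb N\}$. Moreover $N_Q=0$, where $N_Q$ is the largest prime dividing an invariant factor of one of the finite groups $\mathrm{gr}(\tau\cap M)/\mathrm{gr}(\tau\cap Q)$, with $\tau$ running over the facets (faces of codimension one) of $\sigma$ and $\mathrm{gr}(\cdot)$ denoting the subgroup of $M$ generated by a set, and $N_Q=0$ if there is no such prime. -/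

import Mathlib

open CategoryTheory TensorProduct Algebra

universe u v w

noncomputable section

/-! ### Local cohomology as a right derived functor -/

section LocalCohomology

variable {R : Type u} [CommRing R]

/-- The submodule `Γ_I(N)` of the elements of `N` that are killed by some power of `I`. -/
def gammaSubmodule (I : Ideal R) (N : Type*) [AddCommGroup N] [Module R N] : Submodule R N where
  carrier := {x | ∃ n : ℕ, ∀ a ∈ I ^ n, a • x = 0}
  zero_mem' := ⟨0, fun a _ => smul_zero a⟩
  add_mem' := by
    rintro x y ⟨n, hn⟩ ⟨m, hm⟩
    refine ⟨n + m, fun a ha => ?_⟩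
    rw [smul_add, hn a (Ideal.pow_le_pow_right (Nat.le_add_right n m) ha),
      hm a (Ideal.pow_le_pow_right (Nat.le_add_left m n) ha), add_zero]
  smul_mem' := by
    rintro c x ⟨n, hn⟩
    exact ⟨n, fun a ha => by rw [smul_comm, hn a ha, smul_zero]⟩

/-- The `I`-torsion functor `Γ_I = H^0_I`, from `R`-modules to `R`-modules. -/
def gammaFunctor (I : Ideal R) : ModuleCat.{u} R ⥤ ModuleCat.{u} R where
  obj N := ModuleCat.of R (gammaSubmodule I N)
  map {N N'} f := ModuleCat.ofHom <| f.hom.restrict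
    (p := gammaSubmodule I N) (q := gammaSubmodule I N') <| by
      rintro x ⟨n, hn⟩
      exact ⟨n, fun a ha => by rw [← map_smul, hn a ha, map_zero]⟩

instance gammaFunctor_additive (I : Ideal R) : (gammaFunctor I).Additive where

/-- The `i`-th local cohomology functor `H^i_I`, the `i`-th right derived functor of `Γ_I`. -/
def localCohomologyFunctor (I : Ideal R) (i : ℕ) : ModuleCat.{u} R ⥤ ModuleCat.{u} R :=
  (gammaFunctor I).rightDerived i

/-- The local cohomology module `H^i_I(R)`. -/
abbrev localCohomologyModule (I : Ideal R) (i : ℕ) : ModuleCat.{u} R :=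
  (localCohomologyFunctor I i).obj (ModuleCat.of R R)

end LocalCohomology

/-! ### Comparison of a resolution with an injective resolution -/

section Lift

variable {C : Type w} [Category.{v} C] [Abelian C]

/-- A morphism `f : X ⟶ Y` extends to a cochain map from any resolution `ε : X ⟶ K` of `X` to any
injective resolution `J` of `Y`. -/
theorem exists_lift_to_injectiveResolution (K : CochainComplex C ℕ) {X Y : C} (ε : X ⟶ K.X 0)
    (hmono : Mono ε) (hε : ε ≫ K.d 0 1 = 0) (h₀ : (ShortComplex.mk ε (K.d 0 1) hε).Exact)
    (h : ∀ n, (ShortComplex.mk _ _ (K.d_comp_d n (n + 1) (n + 2))).Exact)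
    (J : InjectiveResolution Y) (f : X ⟶ Y) :
    ∃ b : K ⟶ J.cocomplex, ε ≫ b.f 0 = f ≫ J.ι.f 0 := by
  let b₀ : K.X 0 ⟶ J.cocomplex.X 0 := Injective.factorThru (f ≫ J.ι.f 0) ε
  have hb₀ : ε ≫ b₀ = f ≫ J.ι.f 0 := Injective.comp_factorThru _ _
  have hw : ε ≫ b₀ ≫ J.cocomplex.d 0 1 = 0 := by
    rw [← Category.assoc, hb₀]
    exact (Category.assoc _ _ _).trans
      ((congrArg (f ≫ ·) J.ι_f_zero_comp_complex_d).trans Limits.comp_zero)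
  let b₁ : K.X 1 ⟶ J.cocomplex.X 1 := h₀.descToInjective (b₀ ≫ J.cocomplex.d 0 1) hw
  have hb₁ : K.d 0 1 ≫ b₁ = b₀ ≫ J.cocomplex.d 0 1 := h₀.comp_descToInjective _ hw
  refine ⟨CochainComplex.mkHom _ _ b₀ b₁ hb₁.symm fun n ⟨g, g', hg⟩ =>
    ⟨(h n).descToInjective (g' ≫ J.cocomplex.d (n + 1) (n + 2)) ?_, ?_⟩, hb₀⟩
  · dsimp
    rw [← reassoc_of% hg, J.cocomplex.d_comp_d, Limits.comp_zero]
  · exact ((h n).comp_descToInjective _ _).symm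

end Lift

/-! ### Frobenius actions and Hartshorne-Speiser-Lyubeznik numbers -/

section Frobenius

variable {R : Type u} [CommRing R] (p : ℕ) [ExpChar R p]

/-- A Frobenius action on an `R`-module `N`:
an additive map `ρ` with `ρ (r • x) = r ^ p • ρ x`. -/
abbrev FrobeniusAction (N : Type*) [AddCommGroup N] [Module R N] :=
  N →ₛₗ[frobenius R p] N

variable {p} in
/-- The nilpotent elements of `N` for a Frobenius action `ρ`. -/
def nilpotentPart {N : Type*} [AddCommGroup N] [Module R N] (ρ : FrobeniusAction (R := R) p N) :
    Set N :=
  {x | ∃ e : ℕ, ρ^[e] x = 0}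

variable {p} in
/-- The Hartshorne-Speiser-Lyubeznik number of a module with a Frobenius action. It takes values
in `ℕ∞`, so that the infimum of the empty set is `⊤`. -/
def hslNumber {N : Type*} [AddCommGroup N] [Module R N] (ρ : FrobeniusAction (R := R) p N) : ℕ∞ :=
  ⨅ e ∈ {e : ℕ | ∀ x ∈ nilpotentPart ρ, ρ^[e] x = 0}, (e : ℕ∞)

/-- Restriction of scalars along the Frobenius map of `R`, the functor `F_*`. -/
abbrev frobeniusPushforward : ModuleCat.{u} R ⥤ ModuleCat.{u} R :=
  ModuleCat.restrictScalars (frobenius R p)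

/-- The Frobenius map of `R`, as an `R`-linear map `R ⟶ F_* R`. -/
def frobeniusHom :
    ModuleCat.of R R ⟶ (frobeniusPushforward p).obj (ModuleCat.of R R) :=
  ModuleCat.ofHom (Y := (frobeniusPushforward p).obj (ModuleCat.of R R))
    { toFun := fun r => (frobenius R p r : R)
      map_add' := fun r s => map_add (frobenius R p) r s
      map_smul' := fun r s => map_mul (frobenius R p) r s }

/-- The inclusion `F_* Γ_I(N) ⟶ Γ_I(F_* N)`. It is an equality if `I` is finitely generated. -/
def gammaComparison (I : Ideal R) :
    gammaFunctor I ⋙ frobeniusPushforward p ⟶ frobeniusPushforward p ⋙ gammaFunctor I where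
  app N := ModuleCat.ofHom
    (X := (frobeniusPushforward p).obj ((gammaFunctor I).obj N))
    (Y := (gammaFunctor I).obj ((frobeniusPushforward p).obj N))
    { toFun := fun x => ⟨(x : gammaSubmodule I N).1, by
        obtain ⟨n, hn⟩ := (x : gammaSubmodule I N).2
        refine ⟨n, fun a ha => hn (frobenius R p a) ?_⟩
        rw [frobenius_def]
        exact Ideal.pow_mem_of_mem _ ha p (expChar_pos R p)⟩
      map_add' := fun _ _ => rfl
      map_smul' := fun _ _ => rfl }

/-- If `P` is an injective resolution of `N` and `J` is an injective resolution of `F_* N`, then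
the identity of `F_* N` extends to a cochain map from the resolution `F_* P` of `F_* N` to `J`. -/
theorem exists_resolutionComparison {N : ModuleCat.{u} R} (P : InjectiveResolution N)
    (J : InjectiveResolution ((frobeniusPushforward p).obj N)) :
    ∃ b : ((frobeniusPushforward (R := R) p).mapHomologicalComplex (ComplexShape.up ℕ)).obj
        P.cocomplex ⟶ J.cocomplex,
      (frobeniusPushforward p).map (P.ι.f 0) ≫ b.f 0 = J.ι.f 0 := by
  have : Mono ((frobeniusPushforward p).map (P.ι.f 0)) :=
    (frobeniusPushforward (R := R) p).map_mono (P.ι.f 0)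
  have hz : (frobeniusPushforward p).map (P.ι.f 0) ≫
      (frobeniusPushforward p).map (P.cocomplex.d 0 1) = 0 := by
    rw [← Functor.map_comp, P.ι_f_zero_comp_complex_d, Functor.map_zero]
  obtain ⟨b, hb⟩ := exists_lift_to_injectiveResolution
    (((frobeniusPushforward (R := R) p).mapHomologicalComplex (ComplexShape.up ℕ)).obj
      P.cocomplex) ((frobeniusPushforward p).map (P.ι.f 0)) this hz
    (P.exact₀.map (frobeniusPushforward p))
    (fun n => (P.exact_succ n).map (frobeniusPushforward p)) J (𝟙 _)
  exact ⟨b, hb.trans (Category.id_comp _)⟩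

/-- A chosen cochain map `F_* P ⟶ J` that extends the identity of `F_* N`
(it is unique up to homotopy). -/
def resolutionComparison {N : ModuleCat.{u} R} (P : InjectiveResolution N)
    (J : InjectiveResolution ((frobeniusPushforward p).obj N)) :
    ((frobeniusPushforward (R := R) p).mapHomologicalComplex (ComplexShape.up ℕ)).obj
      P.cocomplex ⟶ J.cocomplex :=
  (exists_resolutionComparison p P J).choose

/-- The canonical map `F_* H^i_I(N) ⟶ H^i_I(F_* N)`. With injective resolutions `P` of `N` and `J`
of `F_* N` it is the composite
`F_* H^i(Γ_I P) ≅ H^i(F_* Γ_I P) ⟶ H^i(Γ_I F_* P) ⟶ H^i(Γ_I J)`. -/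
def localCohomologyComparison (I : Ideal R) (i : ℕ) (N : ModuleCat.{u} R) :
    (frobeniusPushforward p).obj ((localCohomologyFunctor I i).obj N) ⟶
      (localCohomologyFunctor I i).obj ((frobeniusPushforward p).obj N) :=
  let P := injectiveResolution N
  let J := injectiveResolution ((frobeniusPushforward p).obj N)
  let c := ComplexShape.up ℕ
  (frobeniusPushforward p).map (P.isoRightDerivedObj (gammaFunctor I) i).hom ≫
    (((((gammaFunctor I).mapHomologicalComplex c).obj P.cocomplex).sc i).mapHomologyIso
      (frobeniusPushforward p)).inv ≫
    HomologicalComplex.homologyMap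
      ((NatTrans.mapHomologicalComplex (gammaComparison p I) c).app P.cocomplex ≫
        ((gammaFunctor I).mapHomologicalComplex c).map (resolutionComparison p P J)) i ≫
    (J.isoRightDerivedObj (gammaFunctor I) i).inv

/-- `ρ` is the natural Frobenius action on `H^i_I(R)`: its composite with the canonical map
`F_* H^i_I(R) ⟶ H^i_I(F_* R)` is the map `H^i_I(R) ⟶ H^i_I(F_* R)` that the Frobenius map
`R ⟶ F_* R` induces by functoriality. -/
def IsNaturalFrobenius (I : Ideal R) (i : ℕ)
    (ρ : FrobeniusAction (R := R) p (localCohomologyModule I i)) : Prop :=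
  ∀ x : localCohomologyModule I i,
    (localCohomologyComparison p I i (ModuleCat.of R R)).hom (ρ x) =
      ((localCohomologyFunctor I i).map (frobeniusHom p)).hom x

end Frobenius

/-! ### Affine semigroups and their semigroup rings -/

section Semigroup

/-- The maximal monomial ideal of `k[Q]`, generated by the monomials `x^v` with `v ∈ Q` not a
unit. -/
def maximalMonomialIdeal (k Q : Type*) [Field k] [AddCommMonoid Q] :
    Ideal (AddMonoidAlgebra k Q) :=
  Ideal.span {f | ∃ v : Q, ¬ IsAddUnit v ∧ f = AddMonoidAlgebra.single v 1}

instance addMonoidAlgebra_charP (k Q : Type*) [Field k] [AddCommMonoid Q] (p : ℕ) [CharP k p] :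
    CharP (AddMonoidAlgebra k Q) p :=
  charP_of_injective_algebraMap (FaithfulSMul.algebraMap_injective k (AddMonoidAlgebra k Q)) p

variable (Q : Type*) [AddCancelCommMonoid Q]

/-- The real vector space `M_ℝ = ℝ ⊗ M`, where `M` is the group generated by `Q`. -/
abbrev realSpace : Type _ := ℝ ⊗[ℤ] GrothendieckAddGroup Q

/-- The cone `σ` in `M_ℝ` generated by `Q`. -/
def cone : PointedCone ℝ (realSpace Q) :=
  PointedCone.hull ℝ (Set.range fun v : Q => (1 : ℝ) ⊗ₜ[ℤ] GrothendieckAddGroup.of v)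

variable {Q} in
/-- `w` generates the group `M` and lies in the cone `σ`. -/
def IsConeGenerator (w : GrothendieckAddGroup Q) : Prop :=
  AddSubgroup.zmultiples w = ⊤ ∧ (1 : ℝ) ⊗ₜ[ℤ] w ∈ cone Q

variable {Q} in
/-- The dimension of a cone (or a face of a cone): the dimension of its real span. -/
def coneDim (τ : Set (realSpace Q)) : ℕ :=
  Module.finrank ℝ (Submodule.span ℝ τ)

/-- `τ` is a face of `σ`: the zero locus on `σ` of a linear form that is nonnegative on `σ`. -/
def IsConeFace (τ : Set (realSpace Q)) : Prop :=
  ∃ u : Module.Dual ℝ (realSpace Q), (∀ v ∈ cone Q, 0 ≤ u v) ∧ τ = {v | v ∈ cone Q ∧ u v = 0}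

/-- `τ` is a facet of `σ`: a face of codimension one. -/
def IsConeFacet (τ : Set (realSpace Q)) : Prop :=
  IsConeFace Q τ ∧ coneDim τ + 1 = coneDim (cone Q : Set (realSpace Q))

variable {Q} in
/-- The subgroup of `M` generated by `τ ∩ M`. -/
def latticeGroup (τ : Set (realSpace Q)) : AddSubgroup (GrothendieckAddGroup Q) :=
  AddSubgroup.closure {v | (1 : ℝ) ⊗ₜ[ℤ] v ∈ τ}

variable {Q} in
/-- The subgroup of `M` generated by `τ ∩ Q`. -/
def semigroupGroup (τ : Set (realSpace Q)) : AddSubgroup (GrothendieckAddGroup Q) :=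
  AddSubgroup.closure {v | (1 : ℝ) ⊗ₜ[ℤ] v ∈ τ ∧ v ∈ Set.range (GrothendieckAddGroup.of (M := Q))}

/-- The number `N_Q`: the largest prime that divides an invariant factor of one of the finite groups
`gr(τ ∩ M) / gr(τ ∩ Q)`, for `τ` a facet of `σ`, and `0` if there is none. A prime divides some
invariant factor of a finite abelian group if and only if it divides the order of the group. -/
def primeBound : ℕ :=
  sSup {q : ℕ | q.Prime ∧ ∃ τ : Set (realSpace Q), IsConeFacet Q τ ∧
    q ∣ (semigroupGroup τ).relIndex (latticeGroup τ)}

end Semigroup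

end

/-! In rank one, `M` is identified with `ℤ` by a degree `D`, and pointedness lets `D` be chosen
nonnegative on `Q` (`exists_degree`); then `w` is the element of degree `1`. Since `Q` generates
`M`, it contains all elements of large degree (`exists_forall_le_exists_degree_eq`). Hence a
monomial `x` of positive degree in `R = k[Q]` generates `𝔪` up to radical, and `R_x = k[M]`.

It follows that `H¹_𝔪(R) = k[M]/k[Q]`. As cohomology is defined by injective resolutions, this is
done by hand: for `A = N_x` and an injective resolution `P` of `N`, extend `N → P⁰` to `f : A → P⁰`
and send `a` to the class of `d (f a)`. The result is `localizationClass`, surjective with kernel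
`N`. It is natural in `N` and is the identity on representatives under `F_* H¹ → H¹(F_*)`, so the
comparison map is bijective and Frobenius becomes `a ↦ a ^ p` on `k[M]/k[Q]`
(`IsNaturalFrobenius.apply_localizationClass`).

The rest is combinatorics. The power `a ^ p ^ e` lies in `k[Q]` iff `p ^ e • m ∈ Q` for every `m` in
the support of `a`. For a nilpotent class all such `m` have degree `≥ 0`, so `m = n • w`, and `p ^ e
• w ∈ Q` then forces `p ^ e • m ∈ Q`. Conversely, the class of `x^w` is nilpotent and dies exactly
when `p ^ e • w ∈ Q`. Finally `N_Q = 0` because a facet has dimension `0`, so its lattice group is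
trivial. -/

section HomologyClass

/-! ### Homology classes in short complexes of modules -/

theorem map_homologyπ_mapHomologyIso_inv {C D : Type*} [Category C] [Category D]
    [Limits.HasZeroMorphisms C] [Limits.HasZeroMorphisms D] (S : ShortComplex C) (F : C ⥤ D)
    [F.PreservesZeroMorphisms] [S.HasHomology] [(S.map F).HasHomology]
    [F.PreservesLeftHomologyOf S] :
    F.map S.homologyπ ≫ (S.mapHomologyIso F).inv =
      (S.mapCyclesIso F).inv ≫ (S.map F).homologyπ := by
  let hl := S.leftHomologyData
  let e : F.obj hl.H ⟶ (S.map F).homology := (hl.map F).homologyIso.inv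
  let e' : F.obj hl.K ⟶ (S.map F).cycles := (hl.map F).cyclesIso.inv
  have h₁ : (S.mapHomologyIso F).inv = F.map hl.homologyIso.hom ≫ e :=
    congrArg Iso.inv (hl.mapHomologyIso_eq F)
  have h₂ : (S.mapCyclesIso F).inv = F.map hl.cyclesIso.hom ≫ e' :=
    congrArg Iso.inv (hl.mapCyclesIso_eq F)
  have h₃ : F.map hl.π ≫ e = e' ≫ (S.map F).homologyπ :=
    (hl.map F).π_comp_homologyIso_inv
  rw [h₁, h₂, ← F.map_comp_assoc, hl.homologyπ_comp_homologyIso_hom, F.map_comp,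
    Category.assoc, Category.assoc, h₃]

variable {R : Type u} [CommRing R]

theorem exists_iCycles_eq (S : ShortComplex (ModuleCat.{u} R)) (z : S.X₂) (hz : S.g z = 0) :
    ∃ c : S.cycles, S.iCycles c = z :=
  ⟨S.moduleCatCyclesIso.inv (⟨z, hz⟩ : LinearMap.ker S.g.hom),
    S.moduleCatCyclesIso_inv_iCycles_apply _⟩

/-- The homology class of a cycle of a short complex of modules. -/
noncomputable def homologyClass (S : ShortComplex (ModuleCat.{u} R)) (z : S.X₂) (hz : S.g z = 0) :
    S.homology :=
  S.homologyπ (exists_iCycles_eq S z hz).choose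

/-- `iCycles` is a monomorphism, so the cycle chosen in `homologyClass` is the only one over `z`. -/
theorem homologyπ_eq_homologyClass (S : ShortComplex (ModuleCat.{u} R)) (c : S.cycles) (z : S.X₂)
    (hz : S.g z = 0) (h : S.iCycles c = z) : S.homologyπ c = homologyClass S z hz := by
  have hinj : Function.Injective S.iCycles := (ModuleCat.mono_iff_injective _).1 inferInstance
  exact congrArg _ (hinj (h.trans (exists_iCycles_eq S z hz).choose_spec.symm))

theorem exists_homologyClass_eq (S : ShortComplex (ModuleCat.{u} R)) (h : S.homology) :
    ∃ z hz, homologyClass S z hz = h := by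
  obtain ⟨c, rfl⟩ := (ModuleCat.epi_iff_surjective S.homologyπ).1 inferInstance h
  have hz : S.g (S.iCycles c) = 0 := by
    rw [← ModuleCat.comp_apply, S.iCycles_g]; rfl
  exact ⟨S.iCycles c, hz, (homologyπ_eq_homologyClass S c _ hz rfl).symm⟩

theorem homologyClass_eq_zero_iff (S : ShortComplex (ModuleCat.{u} R)) (z : S.X₂) (hz : S.g z = 0) :
    homologyClass S z hz = 0 ↔ ∃ y, S.f y = z := by
  have hinj : Function.Injective S.iCycles := (ModuleCat.mono_iff_injective _).1 inferInstance
  have hex : (ShortComplex.mk S.toCycles S.homologyπ (by simp)).Exact :=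
    ShortComplex.exact_of_g_is_cokernel _ S.homologyIsCokernel
  obtain ⟨c, hc⟩ := exists_iCycles_eq S z hz
  rw [← homologyπ_eq_homologyClass S c z hz hc]
  constructor
  · intro h
    obtain ⟨y, hy⟩ := (ShortComplex.moduleCat_exact_iff _).1 hex c h
    refine ⟨y, ?_⟩
    rw [← hc, ← S.toCycles_i, ModuleCat.comp_apply]
    exact congrArg _ hy
  · rintro ⟨y, hy⟩
    have : S.toCycles y = c := hinj <| by
      rw [hc, ← hy, ← ModuleCat.comp_apply, S.toCycles_i]
    rw [← this, ← ModuleCat.comp_apply, S.toCycles_comp_homologyπ]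
    rfl

theorem homologyClass_add (S : ShortComplex (ModuleCat.{u} R)) (z z' : S.X₂) (hz : S.g z = 0)
    (hz' : S.g z' = 0) (h : S.g (z + z') = 0) :
    homologyClass S (z + z') h = homologyClass S z hz + homologyClass S z' hz' := by
  obtain ⟨c, hc⟩ := exists_iCycles_eq S z hz
  obtain ⟨c', hc'⟩ := exists_iCycles_eq S z' hz'
  rw [← homologyπ_eq_homologyClass S c z hz hc, ← homologyπ_eq_homologyClass S c' z' hz' hc',
    ← map_add]
  exact (homologyπ_eq_homologyClass S _ _ h (by rw [map_add, hc, hc'])).symm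

theorem homologyClass_smul (S : ShortComplex (ModuleCat.{u} R)) (r : R) (z : S.X₂) (hz : S.g z = 0)
    (h : S.g (r • z) = 0) :
    homologyClass S (r • z) h = r • homologyClass S z hz := by
  obtain ⟨c, hc⟩ := exists_iCycles_eq S z hz
  rw [← homologyπ_eq_homologyClass S c z hz hc, ← map_smul]
  exact (homologyπ_eq_homologyClass S _ _ h (by rw [map_smul, hc])).symm

theorem homologyMap_homologyClass {S T : ShortComplex (ModuleCat.{u} R)} (φ : S ⟶ T) (z : S.X₂)
    (hz : S.g z = 0) (h : T.g (φ.τ₂ z) = 0) :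
    ShortComplex.homologyMap φ (homologyClass S z hz) = homologyClass T (φ.τ₂ z) h := by
  obtain ⟨c, hc⟩ := exists_iCycles_eq S z hz
  rw [← homologyπ_eq_homologyClass S c z hz hc, ← ModuleCat.comp_apply,
    ShortComplex.homologyπ_naturality, ModuleCat.comp_apply]
  apply homologyπ_eq_homologyClass
  rw [← ModuleCat.comp_apply, ShortComplex.cyclesMap_i, ModuleCat.comp_apply, hc]

/-- Restriction of scalars keeps the underlying sets, so its exchange with homology is the identity
on representatives. -/
theorem mapHomologyIso_inv_homologyClass {R' : Type u} [CommRing R'] (f : R' →+* R)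
    (S : ShortComplex (ModuleCat.{u} R)) (z : S.X₂) (hz : S.g z = 0) :
    (S.mapHomologyIso (ModuleCat.restrictScalars f)).inv (homologyClass S z hz) =
      homologyClass (S.map (ModuleCat.restrictScalars f)) z hz := by
  obtain ⟨c, hc⟩ := exists_iCycles_eq S z hz
  rw [← homologyπ_eq_homologyClass S c z hz hc]
  have h := congrArg (fun g => g c)
    (map_homologyπ_mapHomologyIso_inv S (ModuleCat.restrictScalars.{u} f))
  refine h.trans ?_
  change (S.map (ModuleCat.restrictScalars.{u} f)).homologyπ
    ((S.mapCyclesIso (ModuleCat.restrictScalars.{u} f)).inv c) = _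
  apply homologyπ_eq_homologyClass
  have h' := (Iso.inv_comp_eq _).2
    (S.mapCyclesIso_hom_iCycles (ModuleCat.restrictScalars.{u} f)).symm
  exact (congrArg (fun g => g c) h').trans hc

end HomologyClass

/-! ### Cohomology classes of degree one -/

section CochainComplex

variable {R : Type u} [CommRing R]

theorem sc_one_g_apply_eq_zero_iff (K : CochainComplex (ModuleCat.{u} R) ℕ) (z : K.X 1) :
    (K.sc 1).g z = 0 ↔ K.d 1 2 z = 0 := by
  -- `sc 1` is built on the index `next 1`, which equals `2` only propositionally; a variable index
  -- lets the equation be substituted.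
  have h : ∀ j, (ComplexShape.up ℕ).next 1 = j → ((K.sc 1).g z = 0 ↔ K.d 1 j z = 0) := by
    rintro _ rfl
    rfl
  exact h 2 (CochainComplex.next ℕ 1)

theorem exists_sc_one_f_apply_eq_iff (K : CochainComplex (ModuleCat.{u} R) ℕ) (z : K.X 1) :
    (∃ y, (K.sc 1).f y = z) ↔ ∃ y, K.d 0 1 y = z := by
  have h : ∀ i, (ComplexShape.up ℕ).prev 1 = i →
      ((∃ y, (K.sc 1).f y = z) ↔ ∃ y, K.d i 1 y = z) := by
    rintro _ rfl
    rfl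
  exact h 0 (CochainComplex.prev_nat_succ 0)

/-- The cohomology class of a cocycle of degree one. -/
noncomputable def cohomologyClass (K : CochainComplex (ModuleCat.{u} R) ℕ) (z : K.X 1)
    (hz : K.d 1 2 z = 0) : K.homology 1 :=
  homologyClass (K.sc 1) z ((sc_one_g_apply_eq_zero_iff K z).2 hz)

theorem cohomologyClass_eq_zero_iff (K : CochainComplex (ModuleCat.{u} R) ℕ) (z : K.X 1)
    (hz : K.d 1 2 z = 0) : cohomologyClass K z hz = 0 ↔ ∃ y, K.d 0 1 y = z :=
  (homologyClass_eq_zero_iff _ _ _).trans (exists_sc_one_f_apply_eq_iff K z)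

theorem exists_cohomologyClass_eq (K : CochainComplex (ModuleCat.{u} R) ℕ) (h : K.homology 1) :
    ∃ z hz, cohomologyClass K z hz = h := by
  obtain ⟨z, hz, rfl⟩ := exists_homologyClass_eq (K.sc 1) h
  exact ⟨z, (sc_one_g_apply_eq_zero_iff K z).1 hz, rfl⟩

theorem cohomologyClass_add (K : CochainComplex (ModuleCat.{u} R) ℕ) {z z' w : K.X 1}
    (hz : K.d 1 2 z = 0) (hz' : K.d 1 2 z' = 0) (hw : K.d 1 2 w = 0) (h : w = z + z') :
    cohomologyClass K w hw = cohomologyClass K z hz + cohomologyClass K z' hz' := by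
  subst h
  exact homologyClass_add _ _ _ _ _ _

theorem cohomologyClass_smul (K : CochainComplex (ModuleCat.{u} R) ℕ) {z w : K.X 1} (r : R)
    (hz : K.d 1 2 z = 0) (hw : K.d 1 2 w = 0) (h : w = r • z) :
    cohomologyClass K w hw = r • cohomologyClass K z hz := by
  subst h
  exact homologyClass_smul _ _ _ _ _

theorem cohomologyClass_eq_iff (K : CochainComplex (ModuleCat.{u} R) ℕ) {z z' : K.X 1}
    (hz : K.d 1 2 z = 0) (hz' : K.d 1 2 z' = 0) :
    cohomologyClass K z hz = cohomologyClass K z' hz' ↔ ∃ y, K.d 0 1 y = z - z' := by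
  have hs : K.d 1 2 (z - z') = 0 := by rw [map_sub, hz, hz', sub_zero]
  rw [cohomologyClass_add K hs hz' hz (sub_add_cancel z z').symm, add_eq_right,
    cohomologyClass_eq_zero_iff]

theorem homologyMap_cohomologyClass {K L : CochainComplex (ModuleCat.{u} R) ℕ} (φ : K ⟶ L)
    (z : K.X 1) (hz : K.d 1 2 z = 0) (h : L.d 1 2 (φ.f 1 z) = 0) :
    HomologicalComplex.homologyMap φ 1 (cohomologyClass K z hz) =
      cohomologyClass L (φ.f 1 z) h :=
  homologyMap_homologyClass _ _ _ _

end CochainComplex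

/-! ### Torsion cohomology of a complex through a localization -/

section Localization

variable {R : Type u} [CommRing R]

/-- The linear map `j : N → A` exhibits `A` as the localization `N_x` of a module `N` on which `x`
is a nonzerodivisor. -/
structure IsInjectiveLocalization (x : R) {N A : Type*} [AddCommGroup N] [Module R N]
    [AddCommGroup A] [Module R A] (j : N →ₗ[R] A) : Prop where
  injective : Function.Injective j
  bijective : Function.Bijective fun a : A => x • a
  exists_smul_eq : ∀ a : A, ∃ (n : ℕ) (y : N), x ^ n • a = j y

namespace IsInjectiveLocalization

variable {x : R} {N A : Type*} [AddCommGroup N] [Module R N]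
    [AddCommGroup A] [Module R A] {j : N →ₗ[R] A}

theorem bijective_pow (h : IsInjectiveLocalization x j) (n : ℕ) :
    Function.Bijective fun a : A => x ^ n • a := by
  induction n with
  | zero => simpa using! Function.bijective_id
  | succ n ih =>
    convert ih.comp h.bijective using 2
    simp [pow_succ, mul_smul]

theorem eq_zero_of_pow_smul_eq_zero (h : IsInjectiveLocalization x j) {n : ℕ} {a : A}
    (ha : x ^ n • a = 0) : a = 0 :=
  (h.bijective_pow n).1 (by simpa using ha)

end IsInjectiveLocalization

/-- The ideal `I` has the same radical as the principal ideal of its element `x`. -/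
structure IsRadicalGenerator (I : Ideal R) (x : R) : Prop where
  mem : x ∈ I
  exists_pow_le : ∃ m : ℕ, I ^ m ≤ Ideal.span {x}

theorem IsRadicalGenerator.mem_gammaSubmodule_iff {I : Ideal R} {x : R}
    (hI : IsRadicalGenerator I x) {N : Type*} [AddCommGroup N] [Module R N] (y : N) :
    y ∈ gammaSubmodule I N ↔ ∃ n : ℕ, x ^ n • y = 0 := by
  constructor
  · rintro ⟨n, hn⟩
    exact ⟨n, hn _ (Ideal.pow_mem_pow hI.mem n)⟩
  · rintro ⟨n, hn⟩
    obtain ⟨m, hm⟩ := hI.exists_pow_le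
    -- `I ^ (m * n) = (I ^ m) ^ n` lies in `(x)ⁿ = (xⁿ)`.
    refine ⟨m * n, fun a ha => ?_⟩
    rw [pow_mul] at ha
    have h := Ideal.pow_right_mono hm n ha
    rw [Ideal.span_singleton_pow, Ideal.mem_span_singleton'] at h
    obtain ⟨b, rfl⟩ := h
    rw [mul_smul, hn, smul_zero]

variable {I : Ideal R} {x : R}
  {N A : Type*} [AddCommGroup N] [Module R N] [AddCommGroup A] [Module R A] {j : N →ₗ[R] A}

/-- The quotient `A / j(N)` is `x`-power torsion, hence so is the image of any map that factors
through it. -/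
theorem IsInjectiveLocalization.apply_mem_gammaSubmodule (hj : IsInjectiveLocalization x j)
    (hI : IsRadicalGenerator I x) {L : Type*} [AddCommGroup L] [Module R L] (g : A →ₗ[R] L)
    (hg : ∀ y, g (j y) = 0) (a : A) : g a ∈ gammaSubmodule I L := by
  rw [hI.mem_gammaSubmodule_iff]
  obtain ⟨n, y, hy⟩ := hj.exists_smul_eq a
  exact ⟨n, by rw [← map_smul, hy, hg]⟩

/-- The complex `Γ_I(K)`. -/
noncomputable abbrev gammaComplex (I : Ideal R) (K : CochainComplex (ModuleCat.{u} R) ℕ) :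
    CochainComplex (ModuleCat.{u} R) ℕ :=
  ((gammaFunctor I).mapHomologicalComplex (ComplexShape.up ℕ)).obj K

theorem d_d_apply (K : CochainComplex (ModuleCat.{u} R) ℕ) (i j k : ℕ) (y : K.X i) :
    K.d j k (K.d i j y) = 0 := by
  rw [← ModuleCat.comp_apply, K.d_comp_d]
  rfl

/-- The class in `H¹(Γ_I(K))` of an `I`-torsion cocycle of degree one. -/
noncomputable def torsionClass (I : Ideal R) (K : CochainComplex (ModuleCat.{u} R) ℕ) (z : K.X 1)
    (hz : z ∈ gammaSubmodule I (K.X 1)) (hd : K.d 1 2 z = 0) : (gammaComplex I K).homology 1 :=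
  cohomologyClass (gammaComplex I K) (⟨z, hz⟩ : gammaSubmodule I (K.X 1)) (Subtype.ext hd)

theorem exists_torsionClass_eq (I : Ideal R) (K : CochainComplex (ModuleCat.{u} R) ℕ)
    (c : (gammaComplex I K).homology 1) : ∃ z hz hd, torsionClass I K z hz hd = c := by
  obtain ⟨⟨z, hz⟩, hd, rfl⟩ := exists_cohomologyClass_eq _ c
  exact ⟨z, hz, congrArg Subtype.val hd, rfl⟩

theorem torsionClass_eq_zero_iff {K : CochainComplex (ModuleCat.{u} R) ℕ} {z : K.X 1}
    (hz : z ∈ gammaSubmodule I (K.X 1)) (hd : K.d 1 2 z = 0) :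
    torsionClass I K z hz hd = 0 ↔ ∃ y ∈ gammaSubmodule I (K.X 0), K.d 0 1 y = z :=
  (cohomologyClass_eq_zero_iff _ _ _).trans
    ⟨fun ⟨⟨y, hy⟩, h⟩ => ⟨y, hy, congrArg Subtype.val h⟩,
      fun ⟨y, hy, h⟩ => ⟨(⟨y, hy⟩ : gammaSubmodule I (K.X 0)), Subtype.ext h⟩⟩

theorem torsionClass_eq_iff {K : CochainComplex (ModuleCat.{u} R) ℕ} {z z' : K.X 1}
    (hz : z ∈ gammaSubmodule I (K.X 1)) (hd : K.d 1 2 z = 0)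
    (hz' : z' ∈ gammaSubmodule I (K.X 1)) (hd' : K.d 1 2 z' = 0) :
    torsionClass I K z hz hd = torsionClass I K z' hz' hd' ↔
      ∃ y ∈ gammaSubmodule I (K.X 0), K.d 0 1 y = z - z' :=
  (cohomologyClass_eq_iff _ _ _).trans
    ⟨fun ⟨⟨y, hy⟩, h⟩ => ⟨y, hy, congrArg Subtype.val h⟩,
      fun ⟨y, hy, h⟩ => ⟨(⟨y, hy⟩ : gammaSubmodule I (K.X 0)), Subtype.ext h⟩⟩

theorem homologyMap_torsionClass {K L : CochainComplex (ModuleCat.{u} R) ℕ} (φ : K ⟶ L) {z : K.X 1}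
    (hz : z ∈ gammaSubmodule I (K.X 1)) (hd : K.d 1 2 z = 0)
    (hz' : φ.f 1 z ∈ gammaSubmodule I (L.X 1)) (hd' : L.d 1 2 (φ.f 1 z) = 0) :
    HomologicalComplex.homologyMap
        (((gammaFunctor I).mapHomologicalComplex (ComplexShape.up ℕ)).map φ) 1
        (torsionClass I K z hz hd) =
      torsionClass I L (φ.f 1 z) hz' hd' :=
  homologyMap_cohomologyClass _ _ _ _

theorem map_d_apply {K L : CochainComplex (ModuleCat.{u} R) ℕ} (φ : K ⟶ L) (i j : ℕ) (y : K.X i) :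
    φ.f j (K.d i j y) = L.d i j (φ.f i y) := by
  rw [← ModuleCat.comp_apply, ← ModuleCat.comp_apply, φ.comm]

theorem d_extension_mem_gammaSubmodule (hj : IsInjectiveLocalization x j)
    (hI : IsRadicalGenerator I x) {K : CochainComplex (ModuleCat.{u} R) ℕ} {f : A →ₗ[R] K.X 0}
    (hf : ∀ y, K.d 0 1 (f (j y)) = 0) (a : A) : K.d 0 1 (f a) ∈ gammaSubmodule I (K.X 1) :=
  hj.apply_mem_gammaSubmodule hI ((K.d 0 1).hom ∘ₗ f) hf a

/-- If `f : A → K⁰` maps the submodule `N` of `A = N_x` to cocycles, then `a ↦ d (f a)` defines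
a linear map `A → H¹(Γ_I(K))`. -/
noncomputable def extensionClass (hj : IsInjectiveLocalization x j) (hI : IsRadicalGenerator I x)
    (K : CochainComplex (ModuleCat.{u} R) ℕ) (f : A →ₗ[R] K.X 0)
    (hf : ∀ y, K.d 0 1 (f (j y)) = 0) : A →ₗ[R] (gammaComplex I K).homology 1 where
  toFun a := torsionClass I K (K.d 0 1 (f a)) (d_extension_mem_gammaSubmodule hj hI hf a)
    (d_d_apply K 0 1 2 (f a))
  map_add' a b := cohomologyClass_add _ _ _ _ <| Subtype.ext <|
    map_add ((K.d 0 1).hom ∘ₗ f) a b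
  map_smul' r a := cohomologyClass_smul _ r _ _ <| Subtype.ext <|
    map_smul ((K.d 0 1).hom ∘ₗ f) r a

theorem extensionClass_apply (hj : IsInjectiveLocalization x j) (hI : IsRadicalGenerator I x)
    (K : CochainComplex (ModuleCat.{u} R) ℕ) (f : A →ₗ[R] K.X 0)
    (hf : ∀ y, K.d 0 1 (f (j y)) = 0) (a : A) :
    extensionClass hj hI K f hf a = torsionClass I K (K.d 0 1 (f a))
      (d_extension_mem_gammaSubmodule hj hI hf a) (d_d_apply K 0 1 2 (f a)) :=
  rfl

/-- The difference `f - f'` kills `N`, so it takes values in `Γ_I(K⁰)`, and the two cocycles differ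
by a coboundary of `Γ_I(K)`. -/
theorem extensionClass_eq_extensionClass (hj : IsInjectiveLocalization x j)
    (hI : IsRadicalGenerator I x) (K : CochainComplex (ModuleCat.{u} R) ℕ)
    (f f' : A →ₗ[R] K.X 0) (hf : ∀ y, K.d 0 1 (f (j y)) = 0)
    (hf' : ∀ y, K.d 0 1 (f' (j y)) = 0) (h : ∀ y, f (j y) = f' (j y)) (a : A) :
    extensionClass hj hI K f hf a = extensionClass hj hI K f' hf' a := by
  rw [extensionClass_apply, extensionClass_apply, torsionClass_eq_iff]
  exact ⟨f a - f' a, hj.apply_mem_gammaSubmodule hI (f - f') (fun y => by simp [h]) a,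
    map_sub _ _ _⟩

/-- If `d (f a) = d y` with `y` torsion, exactness gives `f a - y = f (j z)`, so `f (a - j z) = y`.
Some power of `x` moves `a - j z` into `N`, where `f` is injective; a further power kills it, and
`x` acts injectively on `A`. -/
theorem extensionClass_eq_zero_iff (hj : IsInjectiveLocalization x j)
    (hI : IsRadicalGenerator I x) (K : CochainComplex (ModuleCat.{u} R) ℕ)
    (f : A →ₗ[R] K.X 0) (hf : ∀ y, K.d 0 1 (f (j y)) = 0)
    (hinj : ∀ y, f (j y) = 0 → y = 0) (h₀ : ∀ y, K.d 0 1 y = 0 → ∃ z, f (j z) = y) (a : A) :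
    extensionClass hj hI K f hf a = 0 ↔ a ∈ Set.range j := by
  rw [extensionClass_apply, torsionClass_eq_zero_iff]
  constructor
  · rintro ⟨y, hy, hya⟩
    obtain ⟨z, hz⟩ := h₀ (f a - y) (by rw [map_sub, hya, sub_self])
    refine ⟨z, (sub_eq_zero.1 ?_).symm⟩
    obtain ⟨n, hn⟩ := (hI.mem_gammaSubmodule_iff y).1 hy
    obtain ⟨m, b, hb⟩ := hj.exists_smul_eq (a - j z)
    have hfy : f (a - j z) = y := by rw [map_sub, hz, sub_sub_cancel]
    have hxb : x ^ n • b = 0 := hinj _ <| by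
      rw [map_smul, ← hb, map_smul, map_smul, hfy, smul_comm, hn, smul_zero]
    refine hj.eq_zero_of_pow_smul_eq_zero (n := n + m) ?_
    rw [pow_add, mul_smul, hb, ← map_smul, hxb, map_zero]
  · rintro ⟨z, rfl⟩
    exact ⟨0, zero_mem _, by rw [map_zero, hf]⟩

/-- A torsion cocycle is `d y` by exactness, and some `xⁿ y` is a cocycle, hence comes from an `r`
in `N`. The preimage is `a = r / xⁿ`, because `xⁿ` kills `f a - y`. -/
theorem extensionClass_surjective (hj : IsInjectiveLocalization x j)
    (hI : IsRadicalGenerator I x) (K : CochainComplex (ModuleCat.{u} R) ℕ)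
    (f : A →ₗ[R] K.X 0) (hf : ∀ y, K.d 0 1 (f (j y)) = 0)
    (h₀ : ∀ y, K.d 0 1 y = 0 → ∃ z, f (j z) = y)
    (h₁ : ∀ y, K.d 1 2 y = 0 → ∃ z, K.d 0 1 z = y) :
    Function.Surjective (extensionClass hj hI K f hf) := by
  intro c
  obtain ⟨z, hz, hd, rfl⟩ := exists_torsionClass_eq I K c
  obtain ⟨y, rfl⟩ := h₁ z hd
  obtain ⟨n, hn⟩ := (hI.mem_gammaSubmodule_iff _).1 hz
  obtain ⟨r, hr⟩ := h₀ (x ^ n • y) (by rw [map_smul, hn])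
  obtain ⟨a, ha⟩ := (hj.bijective_pow n).2 (j r)
  refine ⟨a, ?_⟩
  rw [extensionClass_apply, torsionClass_eq_iff]
  refine ⟨f a - y, (hI.mem_gammaSubmodule_iff _).2 ⟨n, ?_⟩, map_sub _ _ _⟩
  rw [smul_sub, ← map_smul, ← hr, sub_eq_zero]
  exact congrArg f ha

variable {N' A' : Type*} [AddCommGroup N'] [Module R N'] [AddCommGroup A'] [Module R A']
  {j' : N' →ₗ[R] A'}

/-- Both `φ ∘ f` and `f' ∘ g` extend the same map on `N`, so independence of the extension applies.
-/
theorem homologyMap_extensionClass (hj : IsInjectiveLocalization x j)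
    (hj' : IsInjectiveLocalization x j') (hI : IsRadicalGenerator I x)
    {K L : CochainComplex (ModuleCat.{u} R) ℕ} (φ : K ⟶ L)
    (f : A →ₗ[R] K.X 0) (hf : ∀ y, K.d 0 1 (f (j y)) = 0)
    (f' : A' →ₗ[R] L.X 0) (hf' : ∀ y, L.d 0 1 (f' (j' y)) = 0) (g : A →ₗ[R] A')
    (h : ∀ y, φ.f 0 (f (j y)) = f' (g (j y))) (hg : ∀ y, g (j y) ∈ Set.range j') (a : A) :
    HomologicalComplex.homologyMap
        (((gammaFunctor I).mapHomologicalComplex (ComplexShape.up ℕ)).map φ) 1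
        (extensionClass hj hI K f hf a) =
      extensionClass hj' hI L f' hf' (g a) := by
  have hφ : ∀ y, L.d 0 1 (((φ.f 0).hom ∘ₗ f) (j y)) = 0 := fun y => by
    change L.d 0 1 (φ.f 0 (f (j y))) = 0
    rw [← map_d_apply, hf, map_zero]
  have hg' : ∀ y, L.d 0 1 ((f' ∘ₗ g) (j y)) = 0 := fun y => by
    obtain ⟨z, hz⟩ := hg y
    rw [LinearMap.comp_apply, ← hz, hf']
  refine Eq.trans ?_ (extensionClass_eq_extensionClass hj hI L ((φ.f 0).hom ∘ₗ f) (f' ∘ₗ g)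
    hφ hg' h a)
  rw [extensionClass_apply, homologyMap_torsionClass, extensionClass_apply]
  · congr 1
    exact map_d_apply φ 0 1 (f a)
  · rw [map_d_apply]
    exact d_extension_mem_gammaSubmodule hj hI hφ a
  · rw [map_d_apply, d_d_apply]

end Localization

/-! ### The map from the localization onto `H¹_I(N)` and its naturality -/

section LocalizationClass

variable {R : Type u} [CommRing R] {I : Ideal R} {x : R} {N : ModuleCat.{u} R}
  {A : Type u} [AddCommGroup A] [Module R A] {j : N →ₗ[R] A}

theorem injectiveResolution_d_ι_apply (P : InjectiveResolution N) (y : N) :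
    P.cocomplex.d 0 1 ((P.ι.f 0).hom y) = 0 :=
  congrArg (fun g => g.hom y) P.ι_f_zero_comp_complex_d

theorem injectiveResolution_ι_injective (P : InjectiveResolution N) :
    Function.Injective ((P.ι.f 0).hom : N → P.cocomplex.X 0) :=
  (ModuleCat.mono_iff_injective (P.ι.f 0)).1 inferInstance

theorem injectiveResolution_exists_ι_eq (P : InjectiveResolution N) (y : P.cocomplex.X 0)
    (hy : P.cocomplex.d 0 1 y = 0) : ∃ z : N, (P.ι.f 0).hom z = y :=
  (ShortComplex.moduleCat_exact_iff _).1 P.exact₀ y hy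

theorem injectiveResolution_exists_d_eq (P : InjectiveResolution N) (y : P.cocomplex.X 1)
    (hy : P.cocomplex.d 1 2 y = 0) : ∃ z, P.cocomplex.d 0 1 z = y :=
  (ShortComplex.moduleCat_exact_iff _).1 (P.exact_succ 0) y hy

theorem exists_extension_ι (hj : Function.Injective j) (P : InjectiveResolution N) :
    ∃ f : A →ₗ[R] P.cocomplex.X 0, ∀ y, f (j y) = (P.ι.f 0).hom y := by
  have : Mono (ModuleCat.ofHom (X := N) (Y := A) j) := (ModuleCat.mono_iff_injective _).2 hj
  let g : N ⟶ P.cocomplex.X 0 := P.ι.f 0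
  refine ⟨(Injective.factorThru g (ModuleCat.ofHom j)).hom, fun y => ?_⟩
  exact congrArg (fun h => h.hom y) (Injective.comp_factorThru g (ModuleCat.ofHom j))

/-- For a localization `A = N_x` at a nonzerodivisor, the canonical map `A → H¹_I(N)`, with
kernel `N`. -/
noncomputable def localizationClass (hj : IsInjectiveLocalization x j)
    (hI : IsRadicalGenerator I x) : A →ₗ[R] (localCohomologyFunctor I 1).obj N :=
  ((injectiveResolution N).isoRightDerivedObj (gammaFunctor I) 1).inv.hom ∘ₗ
    extensionClass hj hI (injectiveResolution N).cocomplex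
      (exists_extension_ι hj.injective (injectiveResolution N)).choose
      fun y => by
        rw [(exists_extension_ι hj.injective (injectiveResolution N)).choose_spec]
        exact injectiveResolution_d_ι_apply _ y

theorem isoRightDerivedObj_hom_localizationClass (hj : IsInjectiveLocalization x j)
    (hI : IsRadicalGenerator I x)
    (f : A →ₗ[R] (injectiveResolution N).cocomplex.X 0)
    (hf : ∀ y, f (j y) = ((injectiveResolution N).ι.f 0).hom y)
    (hf' : ∀ y, (injectiveResolution N).cocomplex.d 0 1 (f (j y)) = 0) (a : A) :
    ((injectiveResolution N).isoRightDerivedObj (gammaFunctor I) 1).hom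
        (localizationClass hj hI a) =
      extensionClass hj hI (injectiveResolution N).cocomplex f hf' a := by
  refine Eq.trans ?_ (extensionClass_eq_extensionClass hj hI _
    (exists_extension_ι hj.injective (injectiveResolution N)).choose f ?_ hf' ?_ a)
  · exact Iso.inv_hom_id_apply
      ((injectiveResolution N).isoRightDerivedObj (gammaFunctor I) 1) _
  · intro y
    rw [(exists_extension_ι hj.injective (injectiveResolution N)).choose_spec, hf]

theorem localizationClass_eq_zero_iff (hj : IsInjectiveLocalization x j)
    (hI : IsRadicalGenerator I x) (a : A) :
    localizationClass hj hI a = 0 ↔ a ∈ Set.range j := by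
  obtain ⟨f, hf⟩ := exists_extension_ι hj.injective (injectiveResolution N)
  have hf' : ∀ y, (injectiveResolution N).cocomplex.d 0 1 (f (j y)) = 0 := fun y => by
    rw [hf]
    exact injectiveResolution_d_ι_apply _ y
  rw [← extensionClass_eq_zero_iff hj hI (injectiveResolution N).cocomplex f hf',
    ← isoRightDerivedObj_hom_localizationClass hj hI f hf hf']
  · refine (map_eq_zero_iff ((injectiveResolution N).isoRightDerivedObj
      (gammaFunctor I) 1).hom.hom ?_).symm
    exact (ModuleCat.mono_iff_injective _).1 inferInstance
  · intro y hy
    rw [hf] at hy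
    exact injectiveResolution_ι_injective _ (hy.trans (map_zero _).symm)
  · intro y hy
    obtain ⟨z, hz⟩ := injectiveResolution_exists_ι_eq _ y hy
    exact ⟨z, (hf z).trans hz⟩

theorem localizationClass_surjective (hj : IsInjectiveLocalization x j)
    (hI : IsRadicalGenerator I x) : Function.Surjective (localizationClass hj hI) := by
  refine ((ModuleCat.epi_iff_surjective ((injectiveResolution N).isoRightDerivedObj
    (gammaFunctor I) 1).inv).1 inferInstance).comp (extensionClass_surjective hj hI _ _ _ ?_ ?_)
  · intro y hy
    obtain ⟨z, hz⟩ := injectiveResolution_exists_ι_eq _ y hy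
    refine ⟨z, Eq.trans ?_ hz⟩
    rw [(exists_extension_ι hj.injective (injectiveResolution N)).choose_spec]
  · exact injectiveResolution_exists_d_eq _

variable {N' : ModuleCat.{u} R} {A' : Type u} [AddCommGroup A'] [Module R A'] {j' : N' →ₗ[R] A'}

theorem localCohomologyFunctor_map_localizationClass (hj : IsInjectiveLocalization x j)
    (hj' : IsInjectiveLocalization x j') (hI : IsRadicalGenerator I x) (φ : N ⟶ N')
    (g : A →ₗ[R] A') (hg : ∀ y, g (j y) = j' (φ y)) (a : A) :
    (localCohomologyFunctor I 1).map φ (localizationClass hj hI a) =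
      localizationClass hj' hI (g a) := by
  let P := injectiveResolution N
  let P' := injectiveResolution N'
  obtain ⟨f, hf⟩ := exists_extension_ι hj.injective P
  obtain ⟨f', hf'⟩ := exists_extension_ι hj'.injective P'
  have hdf : ∀ y, P.cocomplex.d 0 1 (f (j y)) = 0 := fun y => by
    rw [hf]
    exact injectiveResolution_d_ι_apply _ y
  have hdf' : ∀ y, P'.cocomplex.d 0 1 (f' (j' y)) = 0 := fun y => by
    rw [hf']
    exact injectiveResolution_d_ι_apply _ y
  let b : P.cocomplex ⟶ P'.cocomplex := InjectiveResolution.desc φ P' P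
  have hb : P.ι.f 0 ≫ b.f 0 = φ ≫ P'.ι.f 0 := InjectiveResolution.desc_commutes_zero φ P' P
  have hinj : Function.Injective (P'.isoRightDerivedObj (gammaFunctor I) 1).hom :=
    (ModuleCat.mono_iff_injective _).1 inferInstance
  apply hinj
  have hnat := InjectiveResolution.isoRightDerivedObj_hom_naturality φ P P' b hb (gammaFunctor I) 1
  have hb' : ∀ y, b.f 0 (f (j y)) = f' (g (j y)) := fun y => by
    rw [hf, hg, hf']
    exact congrArg (fun h => h.hom y) hb
  refine (congrArg (fun h => h.hom (localizationClass hj hI a)) hnat).trans ?_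
  refine Eq.trans ?_ (isoRightDerivedObj_hom_localizationClass hj' hI f' hf' hdf' (g a)).symm
  refine (congrArg (HomologicalComplex.homologyMap
    (((gammaFunctor I).mapHomologicalComplex (ComplexShape.up ℕ)).map b) 1)
    (isoRightDerivedObj_hom_localizationClass hj hI f hf hdf a)).trans ?_
  exact homologyMap_extensionClass hj hj' hI b f hdf f' hdf' g hb'
    (fun y => ⟨φ y, (hg y).symm⟩) a

end LocalizationClass

/-! ### The canonical map `F_* H¹_I(N) → H¹_I(F_* N)` on representatives -/

section Comparison

variable {R : Type u} [CommRing R] {I : Ideal R} {x : R} {N : ModuleCat.{u} R}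
  {A : Type u} [AddCommGroup A] [Module R A] {j : N →ₗ[R] A} (p : ℕ) [ExpChar R p]

/-- Restriction of scalars along the Frobenius map, applied to a linear map. -/
noncomputable def frobeniusPushforwardMap {N A : ModuleCat.{u} R} (j : N →ₗ[R] A) :
    (frobeniusPushforward p).obj N →ₗ[R] (frobeniusPushforward p).obj A :=
  ((frobeniusPushforward p).map (ModuleCat.ofHom j)).hom

theorem isInjectiveLocalization_frobeniusPushforwardMap
    (hj : IsInjectiveLocalization x j) :
    IsInjectiveLocalization x (frobeniusPushforwardMap p (A := ModuleCat.of R A) j) where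
  injective := hj.injective
  bijective := hj.bijective_pow p
  exists_smul_eq a := by
    obtain ⟨n, y, hy⟩ := hj.exists_smul_eq (show A from a)
    -- On `F_* A` the element `xⁿ` acts as `x ^ (p * n)`; after `x ^ n` has moved `a` into `N`, the
    -- factor `x ^ ((p - 1) * n)` is left over.
    refine ⟨n, show (frobeniusPushforward p).obj N from (show N from x ^ ((p - 1) * n) • y), ?_⟩
    refine (show x ^ n • a = (frobenius R p (x ^ n)) • (show A from a) from rfl).trans ?_
    refine Eq.trans ?_ (show j (x ^ ((p - 1) * n) • y) = _ from rfl)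
    rw [frobenius_def, map_smul, ← hy, ← mul_smul, ← pow_mul, ← pow_add]
    congr 2
    obtain ⟨q, hq⟩ := Nat.exists_eq_succ_of_ne_zero (expChar_pos R p).ne'
    simp [hq]
    ring

theorem homologyMap_gammaComparison_torsionClass (K : CochainComplex (ModuleCat.{u} R) ℕ)
    (z : K.X 1) (hz : z ∈ gammaSubmodule I (K.X 1)) (hd : K.d 1 2 z = 0)
    (hz' : (z : (frobeniusPushforward p).obj (K.X 1)) ∈
      gammaSubmodule I ((frobeniusPushforward p).obj (K.X 1))) :
    HomologicalComplex.homologyMap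
        ((NatTrans.mapHomologicalComplex (gammaComparison p I) (ComplexShape.up ℕ)).app K) 1
        ((((gammaComplex I K).sc 1).mapHomologyIso (frobeniusPushforward p)).inv
          (torsionClass I K z hz hd)) =
      torsionClass I (((frobeniusPushforward (R := R) p).mapHomologicalComplex
        (ComplexShape.up ℕ)).obj K) z hz' hd := by
  have h := mapHomologyIso_inv_homologyClass (frobenius R p) ((gammaComplex I K).sc 1)
    (⟨z, hz⟩ : gammaSubmodule I (K.X 1))
    ((sc_one_g_apply_eq_zero_iff (gammaComplex I K) _).2 (Subtype.ext hd))
  refine (congrArg (HomologicalComplex.homologyMap ((NatTrans.mapHomologicalComplex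
    (gammaComparison p I) (ComplexShape.up ℕ)).app K) 1) h).trans ?_
  exact homologyMap_homologyClass _ _ _
    ((sc_one_g_apply_eq_zero_iff (gammaComplex I
        (((frobeniusPushforward (R := R) p).mapHomologicalComplex (ComplexShape.up ℕ)).obj K))
      (⟨z, hz'⟩ : gammaSubmodule I ((frobeniusPushforward p).obj (K.X 1)))).2 (Subtype.ext hd))


/-- The complex `F_* K`. -/
noncomputable abbrev frobeniusPushforwardComplex (K : CochainComplex (ModuleCat.{u} R) ℕ) :
    CochainComplex (ModuleCat.{u} R) ℕ :=
  ((frobeniusPushforward (R := R) p).mapHomologicalComplex (ComplexShape.up ℕ)).obj K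

theorem homologyMap_gammaComparison_extensionClass (K : CochainComplex (ModuleCat.{u} R) ℕ)
    (hj : IsInjectiveLocalization x j) (hI : IsRadicalGenerator I x)
    (f : A →ₗ[R] K.X 0) (hf : ∀ y, K.d 0 1 (f (j y)) = 0)
    (hf' : ∀ y, (frobeniusPushforwardComplex p K).d 0 1
      (frobeniusPushforwardMap p (N := ModuleCat.of R A) f
        (frobeniusPushforwardMap p (A := ModuleCat.of R A) j y)) = 0) (a : A) :
    HomologicalComplex.homologyMap
        ((NatTrans.mapHomologicalComplex (gammaComparison p I) (ComplexShape.up ℕ)).app K) 1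
        ((((gammaComplex I K).sc 1).mapHomologyIso (frobeniusPushforward p)).inv
          (extensionClass hj hI K f hf a)) =
      extensionClass (isInjectiveLocalization_frobeniusPushforwardMap p hj) hI
        (frobeniusPushforwardComplex p K)
        (frobeniusPushforwardMap p (N := ModuleCat.of R A) f) hf' a :=
  homologyMap_gammaComparison_torsionClass p K (K.d 0 1 (f a))
    (d_extension_mem_gammaSubmodule hj hI hf a) (d_d_apply K 0 1 2 (f a))
    (d_extension_mem_gammaSubmodule (isInjectiveLocalization_frobeniusPushforwardMap p hj) hI
      (K := frobeniusPushforwardComplex p K) hf' a)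

theorem homologyMap_comp_apply {K L M : CochainComplex (ModuleCat.{u} R) ℕ} (φ : K ⟶ L)
    (ψ : L ⟶ M) (i : ℕ) (c : K.homology i) :
    HomologicalComplex.homologyMap (φ ≫ ψ) i c =
      HomologicalComplex.homologyMap ψ i (HomologicalComplex.homologyMap φ i c) := by
  rw [HomologicalComplex.homologyMap_comp, ModuleCat.comp_apply]

theorem isoRightDerivedObj_hom_localCohomologyComparison (i : ℕ)
    (c : (localCohomologyFunctor I i).obj N) :
    ((injectiveResolution ((frobeniusPushforward p).obj N)).isoRightDerivedObj
        (gammaFunctor I) i).hom ((localCohomologyComparison p I i N).hom c) =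
      HomologicalComplex.homologyMap
        (((gammaFunctor I).mapHomologicalComplex (ComplexShape.up ℕ)).map
          (resolutionComparison p (injectiveResolution N)
            (injectiveResolution ((frobeniusPushforward p).obj N)))) i
        (HomologicalComplex.homologyMap
          ((NatTrans.mapHomologicalComplex (gammaComparison p I) (ComplexShape.up ℕ)).app
            (injectiveResolution N).cocomplex) i
          ((((gammaComplex I (injectiveResolution N).cocomplex).sc i).mapHomologyIso
            (frobeniusPushforward p)).inv
            (((injectiveResolution N).isoRightDerivedObj (gammaFunctor I) i).hom c))) := by
  refine (Iso.inv_hom_id_apply ((injectiveResolution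
    ((frobeniusPushforward p).obj N)).isoRightDerivedObj (gammaFunctor I) i) _).trans ?_
  exact homologyMap_comp_apply
    (L := gammaComplex I (frobeniusPushforwardComplex p (injectiveResolution N).cocomplex))
    ((NatTrans.mapHomologicalComplex (gammaComparison p I) (ComplexShape.up ℕ)).app
      (injectiveResolution N).cocomplex)
    (((gammaFunctor I).mapHomologicalComplex (ComplexShape.up ℕ)).map
      (resolutionComparison p (injectiveResolution N)
        (injectiveResolution ((frobeniusPushforward p).obj N)))) i _

/-- The resolution comparison extends the identity of `F_* N`, so `homologyMap_extensionClass`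
applies with the identity of `F_* A` as `g`. -/
theorem localCohomologyComparison_localizationClass (hj : IsInjectiveLocalization x j)
    (hI : IsRadicalGenerator I x) (a : A) :
    (localCohomologyComparison p I 1 N).hom (localizationClass hj hI a) =
      localizationClass (isInjectiveLocalization_frobeniusPushforwardMap p hj) hI
        (show (frobeniusPushforward p).obj (ModuleCat.of R A) from a) := by
  have hj' := isInjectiveLocalization_frobeniusPushforwardMap p hj
  obtain ⟨f, hf⟩ := exists_extension_ι hj.injective (injectiveResolution N)
  obtain ⟨f', hf'⟩ := exists_extension_ι hj'.injective
    (injectiveResolution ((frobeniusPushforward p).obj N))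
  have hdf : ∀ y, (injectiveResolution N).cocomplex.d 0 1 (f (j y)) = 0 := fun y => by
    rw [hf]
    exact injectiveResolution_d_ι_apply _ y
  have hdf' : ∀ y, (injectiveResolution ((frobeniusPushforward p).obj N)).cocomplex.d 0 1
      (f' (frobeniusPushforwardMap p (A := ModuleCat.of R A) j y)) = 0 := fun y => by
    rw [hf']
    exact injectiveResolution_d_ι_apply _ y
  have hb : (frobeniusPushforward p).map ((injectiveResolution N).ι.f 0) ≫
      (resolutionComparison p (injectiveResolution N)
        (injectiveResolution ((frobeniusPushforward p).obj N))).f 0 =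
      (injectiveResolution ((frobeniusPushforward p).obj N)).ι.f 0 :=
    (exists_resolutionComparison p _ _).choose_spec
  have hinj : Function.Injective ((injectiveResolution
      ((frobeniusPushforward p).obj N)).isoRightDerivedObj (gammaFunctor I) 1).hom :=
    (ModuleCat.mono_iff_injective _).1 inferInstance
  apply hinj
  rw [isoRightDerivedObj_hom_localCohomologyComparison,
    isoRightDerivedObj_hom_localizationClass hj hI f hf hdf,
    isoRightDerivedObj_hom_localizationClass hj' hI f' hf' hdf',
    homologyMap_gammaComparison_extensionClass p _ hj hI f hdf hdf]
  have hbf : ∀ y, (resolutionComparison p (injectiveResolution N)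
        (injectiveResolution ((frobeniusPushforward p).obj N))).f 0
      (frobeniusPushforwardMap p (N := ModuleCat.of R A) f
        (frobeniusPushforwardMap p (A := ModuleCat.of R A) j y)) =
      f' (frobeniusPushforwardMap p (A := ModuleCat.of R A) j y) := fun y => by
    rw [hf']
    refine Eq.trans ?_ (congrArg (fun h => h.hom y) hb)
    exact congrArg ((resolutionComparison p (injectiveResolution N)
        (injectiveResolution ((frobeniusPushforward p).obj N))).f 0).hom (hf y)
  exact homologyMap_extensionClass hj' hj' hI
    (resolutionComparison p (injectiveResolution N)
      (injectiveResolution ((frobeniusPushforward p).obj N)))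
    (frobeniusPushforwardMap p (N := ModuleCat.of R A) f) hdf f' hdf' LinearMap.id hbf
    (fun y => ⟨y, rfl⟩) a

end Comparison

/-! ### Existence, uniqueness and formula for the natural Frobenius -/

section NaturalFrobenius

variable {R : Type u} [CommRing R] {I : Ideal R} {x : R} (p : ℕ) [ExpChar R p]

/-- Both sides are the quotient of the same set `A` by the same subset `j(N)`, and the map is the
identity on representatives. -/
theorem localCohomologyComparison_bijective {N : ModuleCat.{u} R} {A : Type u} [AddCommGroup A]
    [Module R A] {j : N →ₗ[R] A} (hj : IsInjectiveLocalization x j)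
    (hI : IsRadicalGenerator I x) :
    Function.Bijective (localCohomologyComparison p I 1 N).hom := by
  have hj' := isInjectiveLocalization_frobeniusPushforwardMap p hj
  constructor
  · refine (injective_iff_map_eq_zero _).2 fun c hc => ?_
    obtain ⟨a, rfl⟩ := localizationClass_surjective hj hI c
    have h := (localCohomologyComparison_localizationClass p hj hI a).symm.trans hc
    exact (localizationClass_eq_zero_iff hj hI a).2 ((localizationClass_eq_zero_iff hj' hI _).1 h)
  · intro c
    obtain ⟨a, rfl⟩ := localizationClass_surjective hj' hI c
    exact ⟨_, localCohomologyComparison_localizationClass p hj hI a⟩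

/-- The Frobenius action on `H^i_I(R)` obtained by inverting the comparison map. -/
noncomputable def naturalFrobenius (i : ℕ)
    (h : Function.Bijective (localCohomologyComparison p I i (ModuleCat.of R R)).hom) :
    FrobeniusAction (R := R) p (localCohomologyModule I i) where
  toFun c := (LinearEquiv.ofBijective _ h).symm
    (((localCohomologyFunctor I i).map (frobeniusHom p)).hom c)
  map_add' c c' := by
    rw [map_add, map_add]
    rfl
  map_smul' r c := by
    rw [map_smul, map_smul]
    rfl

theorem isNaturalFrobenius_naturalFrobenius (i : ℕ)
    (h : Function.Bijective (localCohomologyComparison p I i (ModuleCat.of R R)).hom) :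
    IsNaturalFrobenius p I i (naturalFrobenius p i h) := fun c =>
  (LinearEquiv.ofBijective _ h).apply_symm_apply
    (((localCohomologyFunctor I i).map (frobeniusHom p)).hom c)

theorem IsNaturalFrobenius.eq_of_injective {i : ℕ}
    (h : Function.Injective (localCohomologyComparison p I i (ModuleCat.of R R)).hom)
    {ρ ρ' : FrobeniusAction (R := R) p (localCohomologyModule I i)}
    (hρ : IsNaturalFrobenius p I i ρ) (hρ' : IsNaturalFrobenius p I i ρ') : ρ' = ρ :=
  LinearMap.ext fun c => h ((hρ' c).trans (hρ c).symm)

variable {A : Type u} [CommRing A] [Algebra R A]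

/-- The Frobenius map of `A` is an `R`-linear map `A → F_* A` extending `R → F_* R`, so naturality
of `localizationClass` computes the action. -/
theorem IsNaturalFrobenius.apply_localizationClass [ExpChar A p]
    (hj : IsInjectiveLocalization x (Algebra.linearMap R A)) (hI : IsRadicalGenerator I x)
    {ρ : FrobeniusAction (R := R) p (localCohomologyModule I 1)}
    (hρ : IsNaturalFrobenius p I 1 ρ) (a : A) :
    ρ (localizationClass (N := ModuleCat.of R R) hj hI a) =
      localizationClass (N := ModuleCat.of R R) hj hI (a ^ p) := by
  apply (localCohomologyComparison_bijective p (N := ModuleCat.of R R) hj hI).1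
  refine (hρ _).trans ?_
  let g : A →ₗ[R] (frobeniusPushforward p).obj (ModuleCat.of R A) :=
    { toFun := fun a => (a ^ p : A)
      map_add' := fun a b => add_pow_expChar a b p
      map_smul' := fun r a => by
        refine (show (r • a) ^ p = r ^ p • a ^ p from smul_pow r a p).trans ?_
        rfl }
  refine (localCohomologyFunctor_map_localizationClass (N := ModuleCat.of R R) hj
    (isInjectiveLocalization_frobeniusPushforwardMap p (N := ModuleCat.of R R) hj) hI
    (frobeniusHom p) g (fun r => ?_) a).trans
    (localCohomologyComparison_localizationClass p (N := ModuleCat.of R R) hj hI (a ^ p)).symm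
  exact (map_pow (algebraMap R A) r p).symm

end NaturalFrobenius

/-! ### Degree, cone generator and facets of a rank-one semigroup -/

section Semigroup

variable (Q : Type v) [AddCancelCommMonoid Q]

theorem nonempty_addEquiv_int [AddMonoid.FG Q] [IsAddTorsionFree Q]
    (hdim : AffineAddMonoid.dim Q = 1) :
    Nonempty (GrothendieckAddGroup Q ≃+ ℤ) :=
  ⟨((Module.finBasisOfFinrankEq ℤ (GrothendieckAddGroup Q) hdim).equivFun.trans
    (LinearEquiv.funUnique (Fin 1) ℤ ℤ)).toAddEquiv⟩

theorem exists_degree [AddMonoid.FG Q] [IsAddTorsionFree Q] [Subsingleton (AddUnits Q)]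
    (hdim : AffineAddMonoid.dim Q = 1) :
    ∃ D : GrothendieckAddGroup Q ≃+ ℤ, ∀ q : Q, 0 ≤ D (GrothendieckAddGroup.of q) := by
  obtain ⟨D⟩ := nonempty_addEquiv_int Q hdim
  by_cases h : ∀ q : Q, 0 ≤ D (GrothendieckAddGroup.of q)
  · exact ⟨D, h⟩
  push Not at h
  obtain ⟨q, hq⟩ := h
  refine ⟨D.trans (AddEquiv.neg ℤ), fun r => ?_⟩
  by_contra! hr
  replace hr : 0 < D (GrothendieckAddGroup.of r) := by simpa using hr
  obtain ⟨m, hm⟩ := Int.eq_ofNat_of_zero_le hr.le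
  obtain ⟨n, hn⟩ := Int.eq_ofNat_of_zero_le (neg_nonneg.2 hq.le)
  -- Here `r` has degree `m > 0` and `q` has degree `-n < 0`; the relation makes `m • q` a unit,
  -- which pointedness excludes.
  have hsum : m • q + n • r = 0 := by
    apply GrothendieckAddGroup.of_injective
    apply D.injective
    simp only [map_add, map_nsmul, map_zero, nsmul_eq_mul]
    rw [hm, show D (GrothendieckAddGroup.of q) = -(n : ℤ) by rw [← hn, neg_neg]]
    simp; ring
  have hu : m • q = 0 :=
    congrArg AddUnits.val (Subsingleton.elim (⟨m • q, n • r, hsum, by rw [add_comm, hsum]⟩) 0)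
  have h0 := congrArg (fun v => D (GrothendieckAddGroup.of v)) hu
  simp only [map_nsmul, map_zero, nsmul_eq_mul, mul_eq_zero] at h0
  rcases h0 with h0 | h0 <;> omega

variable {Q} (D : GrothendieckAddGroup Q ≃+ ℤ)

/-- Writing degree `1` as a difference gives elements of `Q` of consecutive degrees `m` and `m + 1`.
If `z = s * m + t` with `t < m ≤ s`, then `z = (s - t) * m + t * (m + 1)`; the bound `m * m` ensures
`m ≤ s`. -/
theorem exists_forall_le_exists_degree_eq (hD : ∀ q : Q, 0 ≤ D (GrothendieckAddGroup.of q)) :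
    ∃ n₀ : ℕ, ∀ z : ℤ, n₀ ≤ z → ∃ q : Q, D (GrothendieckAddGroup.of q) = z := by
  obtain ⟨⟨a, b⟩, hab⟩ := (AddLocalization.addMonoidOf (⊤ : AddSubmonoid Q)).surj (D.symm 1)
  have hab' : D (GrothendieckAddGroup.of a) = 1 + D (GrothendieckAddGroup.of (b : Q)) := by
    rw [← D.apply_symm_apply 1, ← map_add]
    exact congrArg D hab.symm
  obtain ⟨m, hm⟩ := Int.eq_ofNat_of_zero_le (hD b)
  refine ⟨m * m, fun z hz => ?_⟩
  lift z to ℕ using by have := Int.natCast_nonneg (m * m); omega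
  replace hz : m * m ≤ z := by exact_mod_cast hz
  rcases Nat.eq_zero_or_pos m with rfl | hmpos
  · exact ⟨z • a, by rw [map_nsmul, map_nsmul, hab', hm]; simp⟩
  have h₁ : m ≤ z / m := (Nat.le_div_iff_mul_le hmpos).2 hz
  have h₂ : z % m < m := Nat.mod_lt _ hmpos
  obtain ⟨c, hc⟩ := Nat.exists_eq_add_of_le (h₂.le.trans h₁)
  refine ⟨c • (b : Q) + (z % m) • a, ?_⟩
  simp only [map_add, map_nsmul, hab', hm, nsmul_eq_mul]
  have h₃ := Nat.div_add_mod z m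
  rw [hc] at h₃
  generalize z % m = r at *
  subst h₃
  push_cast
  ring

/-- The linear isomorphism `M_ℝ ≃ ℝ` that extends an isomorphism `M ≃ ℤ`. -/
noncomputable def realDegree : realSpace Q ≃ₗ[ℝ] ℝ :=
  (AlgebraTensorModule.congr (LinearEquiv.refl ℝ ℝ) D.toIntLinearEquiv).trans
    (AlgebraTensorModule.rid ℤ ℝ ℝ)

theorem realDegree_one_tmul (v : GrothendieckAddGroup Q) : realDegree D (1 ⊗ₜ[ℤ] v) = D v := by
  simp [realDegree]

theorem realDegree_nonneg (hD : ∀ q : Q, 0 ≤ D (GrothendieckAddGroup.of q)) {v : realSpace Q}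
    (hv : v ∈ cone Q) : 0 ≤ realDegree D v := by
  induction hv using Submodule.span_induction with
  | mem v hv =>
    obtain ⟨q, rfl⟩ := hv
    change 0 ≤ realDegree D (1 ⊗ₜ[ℤ] GrothendieckAddGroup.of q)
    rw [realDegree_one_tmul]
    exact_mod_cast hD q
  | zero => simp
  | add v w _ _ hv hw => rw [map_add]; exact add_nonneg hv hw
  | smul c v _ hv =>
    have : realDegree D (c • v) = (c : ℝ) * realDegree D v := (realDegree D).map_smul (c : ℝ) v
    rw [this]
    exact mul_nonneg c.2 hv

theorem isConeGenerator_iff (hD : ∀ q : Q, 0 ≤ D (GrothendieckAddGroup.of q))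
    (w : GrothendieckAddGroup Q) : IsConeGenerator w ↔ w = D.symm 1 := by
  constructor
  · rintro ⟨h, hw⟩
    have h₀ := realDegree_nonneg D hD hw
    rw [realDegree_one_tmul] at h₀
    have h₁ : D.symm 1 ∈ AddSubgroup.zmultiples w := h ▸ AddSubgroup.mem_top _
    obtain ⟨n, hn⟩ := AddSubgroup.mem_zmultiples_iff.1 h₁
    have h₂ := congrArg D hn
    rw [map_zsmul, D.apply_symm_apply, smul_eq_mul] at h₂
    rw [AddEquiv.eq_symm_apply]
    rcases Int.eq_one_or_neg_one_of_mul_eq_one' h₂ with h₃ | h₃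
    · exact h₃.2
    · rw [h₃.2] at h₀
      norm_num at h₀
  · rintro rfl
    refine ⟨eq_top_iff.2 fun v _ => AddSubgroup.mem_zmultiples_iff.2 ⟨D v, D.injective ?_⟩, ?_⟩
    · simp
    · obtain ⟨n₀, hn₀⟩ := exists_forall_le_exists_degree_eq D hD
      -- The shift by one makes the degree positive even if `n₀ = 0`; `w` is then a positive real
      -- multiple of an element of `Q`.
      obtain ⟨q, hq⟩ := hn₀ (n₀ + 1) (by omega)
      have hmem : (1 : ℝ) ⊗ₜ[ℤ] GrothendieckAddGroup.of q ∈ cone Q :=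
        Submodule.subset_span ⟨q, rfl⟩
      have h := (cone Q).smul_mem (show (0 : ℝ) ≤ (n₀ + 1 : ℝ)⁻¹ by positivity) hmem
      convert h using 1
      apply (realDegree D).injective
      refine Eq.trans ?_ ((realDegree D).map_smul ((n₀ + 1 : ℝ)⁻¹) _).symm
      rw [realDegree_one_tmul, realDegree_one_tmul, hq, D.apply_symm_apply]
      push_cast
      rw [smul_eq_mul, inv_mul_cancel₀ (by positivity)]

/-- The ambient space is a line, so codimension one leaves dimension zero. -/
theorem IsConeFacet.eq_zero_of_mem (D : GrothendieckAddGroup Q ≃+ ℤ) {τ : Set (realSpace Q)}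
    (hτ : IsConeFacet Q τ) {v : realSpace Q} (hv : v ∈ τ) : v = 0 := by
  have hfin : FiniteDimensional ℝ (realSpace Q) := (realDegree D).symm.finiteDimensional
  have h₁ : coneDim (cone Q : Set (realSpace Q)) ≤ 1 := by
    refine (Submodule.finrank_le _).trans ?_
    rw [(realDegree D).finrank_eq, Module.finrank_self]
  have h₂ : coneDim τ = 0 := by
    have := hτ.2
    omega
  have h₃ := Submodule.finrank_eq_zero.1 h₂
  have h₄ : v ∈ Submodule.span ℝ τ := Submodule.subset_span hv
  rwa [h₃, Submodule.mem_bot] at h₄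

theorem primeBound_eq_zero_of_addEquiv (D : GrothendieckAddGroup Q ≃+ ℤ) : primeBound Q = 0 := by
  have : {q : ℕ | q.Prime ∧ ∃ τ : Set (realSpace Q), IsConeFacet Q τ ∧
      q ∣ (semigroupGroup τ).relIndex (latticeGroup τ)} = ∅ := by
    refine Set.eq_empty_of_forall_notMem ?_
    rintro q ⟨hq, τ, hτ, hdvd⟩
    have hl : latticeGroup τ = ⊥ := by
      refine AddSubgroup.closure_eq_bot_iff.2 fun v hv => ?_
      have h := congrArg (realDegree D) (hτ.eq_zero_of_mem D hv)
      rw [realDegree_one_tmul, map_zero] at h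
      exact D.map_eq_zero_iff.1 (by exact_mod_cast h)
    rw [hl, AddSubgroup.relIndex_bot_right] at hdvd
    exact hq.one_lt.ne' (Nat.dvd_one.1 hdvd)
  -- The supremum of the empty set in `ℕ` is `0`, in accordance with the convention for `N_Q`.
  rw [primeBound, this, csSup_empty]
  rfl

end Semigroup

/-! ### The group ring `k[M]` as a localization of `k[Q]`, and its `p`-th powers -/

section SemigroupRing

variable (k : Type u) [Field k] {Q : Type v} [AddCancelCommMonoid Q]

/-- The group ring `k[M]` as an algebra over the semigroup ring `k[Q]`. -/
noncomputable instance grothendieckAlgebra :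
    Algebra (AddMonoidAlgebra k Q) (AddMonoidAlgebra k (GrothendieckAddGroup Q)) :=
  (AddMonoidAlgebra.mapDomainRingHom k (GrothendieckAddGroup.of (M := Q))).toAlgebra

variable {k}

theorem algebraMap_grothendieck_single (q : Q) (c : k) :
    algebraMap (AddMonoidAlgebra k Q) (AddMonoidAlgebra k (GrothendieckAddGroup Q))
      (AddMonoidAlgebra.single q c) = AddMonoidAlgebra.single (GrothendieckAddGroup.of q) c :=
  AddMonoidAlgebra.mapDomain_single

theorem algebraMap_grothendieck_injective : Function.Injective
    (algebraMap (AddMonoidAlgebra k Q) (AddMonoidAlgebra k (GrothendieckAddGroup Q))) :=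
  AddMonoidAlgebra.mapDomain_injective GrothendieckAddGroup.of_injective

theorem mem_range_of_mem_range_algebraMap {f : AddMonoidAlgebra k (GrothendieckAddGroup Q)}
    (hf : f ∈ Set.range (algebraMap (AddMonoidAlgebra k Q) _)) {m : GrothendieckAddGroup Q}
    (hm : f.coeff m ≠ 0) : m ∈ Set.range (GrothendieckAddGroup.of (M := Q)) := by
  obtain ⟨g, rfl⟩ := hf
  by_contra h
  exact hm (Finsupp.mapDomain_of_notMem_range _ _ h)

variable (D : GrothendieckAddGroup Q ≃+ ℤ)

/-- Since `D` is injective, only `0` has degree zero; each nonunit contributes degree at least one.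
-/
theorem maximalMonomialIdeal_pow_le (hD : ∀ q : Q, 0 ≤ D (GrothendieckAddGroup.of q)) (n : ℕ) :
    maximalMonomialIdeal k Q ^ n ≤ Ideal.span
      {f | ∃ q : Q, (n : ℤ) ≤ D (GrothendieckAddGroup.of q) ∧ f = AddMonoidAlgebra.single q 1} := by
  induction n with
  | zero =>
    rw [pow_zero, Ideal.one_eq_top, top_le_iff, Ideal.eq_top_iff_one]
    exact Ideal.subset_span ⟨0, hD 0, rfl⟩
  | succ n ih =>
    rw [pow_succ]
    refine (Ideal.mul_mono_left ih).trans ?_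
    rw [maximalMonomialIdeal, Ideal.span_mul_span', Ideal.span_le]
    rintro _ ⟨_, ⟨q, hq, rfl⟩, _, ⟨r, hr, rfl⟩, rfl⟩
    refine Ideal.subset_span ⟨q + r, ?_, ?_⟩
    · have h₁ := hD r
      have h₂ : D (GrothendieckAddGroup.of r) ≠ 0 := by
        intro h
        rw [map_eq_zero_iff D D.injective] at h
        exact hr (GrothendieckAddGroup.of_injective (h.trans (map_zero _).symm) ▸ isAddUnit_zero)
      rw [map_add, map_add]
      push_cast
      omega
    · simp [AddMonoidAlgebra.single_mul_single]

theorem isRadicalGenerator_single (hD : ∀ q : Q, 0 ≤ D (GrothendieckAddGroup.of q)) {v : Q}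
    (hv : ¬ IsAddUnit v) :
    IsRadicalGenerator (maximalMonomialIdeal k Q) (AddMonoidAlgebra.single v 1) where
  mem := Ideal.subset_span ⟨v, hv, rfl⟩
  exists_pow_le := by
    obtain ⟨n₀, hn₀⟩ := exists_forall_le_exists_degree_eq D hD
    obtain ⟨d, hd⟩ := Int.eq_ofNat_of_zero_le (hD v)
    refine ⟨n₀ + d, (maximalMonomialIdeal_pow_le D hD _).trans (Ideal.span_le.2 ?_)⟩
    rintro _ ⟨q, hq, rfl⟩
    -- A monomial of degree at least `n₀ + d` is divisible by `x^v`: the quotient has degree at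
    -- least `n₀`, so it lies in `k[Q]`.
    obtain ⟨r, hr⟩ := hn₀ (D (GrothendieckAddGroup.of q) - d) (by push_cast at hq; omega)
    refine Ideal.mem_span_singleton'.2 ⟨AddMonoidAlgebra.single r 1, ?_⟩
    rw [AddMonoidAlgebra.single_mul_single, one_mul]
    congr 1
    apply GrothendieckAddGroup.of_injective
    apply D.injective
    rw [map_add, map_add, hr, hd, sub_add_cancel]

theorem isInjectiveLocalization_single (hD : ∀ q : Q, 0 ≤ D (GrothendieckAddGroup.of q)) {v : Q}
    (hv : 0 < D (GrothendieckAddGroup.of v)) :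
    IsInjectiveLocalization (AddMonoidAlgebra.single v 1) (Algebra.linearMap (AddMonoidAlgebra k Q)
      (AddMonoidAlgebra k (GrothendieckAddGroup Q))) where
  injective := algebraMap_grothendieck_injective
  bijective := by
    have hu : IsUnit (AddMonoidAlgebra.single (GrothendieckAddGroup.of v) (1 : k)) := by
      refine IsUnit.of_mul_eq_one (AddMonoidAlgebra.single (-GrothendieckAddGroup.of v) 1) ?_
      rw [AddMonoidAlgebra.single_mul_single, add_neg_cancel, one_mul]
      rfl
    obtain ⟨u, hu⟩ := hu
    convert u.mulLeft_bijective using 2 with a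
    rw [hu, Algebra.smul_def, algebraMap_grothendieck_single]
  exists_smul_eq f := by
    obtain ⟨n₀, hn₀⟩ := exists_forall_le_exists_degree_eq D hD
    -- Asking for all large exponents lets the bounds of two summands be merged by a maximum.
    have key : ∀ f : AddMonoidAlgebra k (GrothendieckAddGroup Q), ∃ N : ℕ, ∀ n ≥ N,
        ∃ y, (AddMonoidAlgebra.single v (1 : k)) ^ n • f =
          Algebra.linearMap (AddMonoidAlgebra k Q) _ y := by
      intro f
      induction f using AddMonoidAlgebra.induction_linear with
      | zero => exact ⟨0, fun n _ => ⟨0, by simp⟩⟩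
      | add f g hf hg =>
        obtain ⟨N, hN⟩ := hf
        obtain ⟨N', hN'⟩ := hg
        refine ⟨max N N', fun n hn => ?_⟩
        obtain ⟨y, hy⟩ := hN n (le_of_max_le_left hn)
        obtain ⟨y', hy'⟩ := hN' n (le_of_max_le_right hn)
        exact ⟨y + y', by rw [smul_add, hy, hy', map_add]⟩
      | single m c =>
        refine ⟨n₀ + (D m).natAbs, fun n hn => ?_⟩
        obtain ⟨q, hq⟩ := hn₀ (n * D (GrothendieckAddGroup.of v) + D m) (by
          have h₁ : (n : ℤ) ≤ n * D (GrothendieckAddGroup.of v) :=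
            le_mul_of_one_le_right (by positivity) hv
          omega)
        refine ⟨AddMonoidAlgebra.single q c, ?_⟩
        rw [Algebra.linearMap_apply, algebraMap_grothendieck_single, Algebra.smul_def,
          AddMonoidAlgebra.single_pow, algebraMap_grothendieck_single,
          AddMonoidAlgebra.single_mul_single, one_pow, one_mul]
        congr 1
        apply D.injective
        rw [hq, map_add, map_nsmul, map_nsmul, nsmul_eq_mul]
    obtain ⟨N, hN⟩ := key f
    exact ⟨N, hN N le_rfl⟩

/-- The `p ^ e`-th power of an element of a group ring in characteristic `p`. -/
theorem coeff_pow_char_pow {M : Type*} [AddCommGroup M] [IsAddTorsionFree M] (p : ℕ)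
    [Fact p.Prime] [CharP k p] (f : AddMonoidAlgebra k M) (e : ℕ) (m : M) :
    (f ^ p ^ e).coeff (p ^ e • m) = f.coeff m ^ p ^ e := by
  have hp : p ^ e ≠ 0 := pow_ne_zero _ (Fact.out (p := p.Prime)).ne_zero
  have hinj : Function.Injective fun m : M => p ^ e • m := nsmul_right_injective hp
  induction f using AddMonoidAlgebra.induction_linear with
  | zero => simp [zero_pow hp]
  | add f g hf hg =>
    rw [add_pow_char_pow, AddMonoidAlgebra.coeff_add, AddMonoidAlgebra.coeff_add,
      Finsupp.add_apply, Finsupp.add_apply, hf, hg, add_pow_char_pow]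
  | single a c =>
    classical
    rw [AddMonoidAlgebra.single_pow, AddMonoidAlgebra.coeff_single, AddMonoidAlgebra.coeff_single,
      Finsupp.single_apply, Finsupp.single_apply, hinj.eq_iff, ite_pow, zero_pow hp]

/-- The `p ^ e`-th power is additive, so it can be taken monomial by monomial. -/
theorem pow_char_pow_mem_range (p : ℕ) [Fact p.Prime] [CharP k p]
    (f : AddMonoidAlgebra k (GrothendieckAddGroup Q)) (e : ℕ)
    (h : ∀ m, f.coeff m ≠ 0 → p ^ e • m ∈ Set.range (GrothendieckAddGroup.of (M := Q))) :
    f ^ p ^ e ∈ Set.range (algebraMap (AddMonoidAlgebra k Q) _) := by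
  have hf : f = ∑ m ∈ f.coeff.support, AddMonoidAlgebra.single m (f.coeff m) :=
    (AddMonoidAlgebra.sum_coeff_single f).symm
  rw [hf, sum_pow_char_pow]
  refine Subring.sum_mem ((algebraMap (AddMonoidAlgebra k Q)
    (AddMonoidAlgebra k (GrothendieckAddGroup Q))).range) fun m hm => ?_
  obtain ⟨q, hq⟩ := h m (Finsupp.mem_support_iff.1 hm)
  exact ⟨AddMonoidAlgebra.single q (f.coeff m ^ p ^ e), by
    rw [algebraMap_grothendieck_single, hq, AddMonoidAlgebra.single_pow]⟩

end SemigroupRing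

/-! ### The Hartshorne-Speiser-Lyubeznik number -/

theorem mainTheorem3
    (Q : Type v) [AddCancelCommMonoid Q] [AddMonoid.FG Q] [IsAddTorsionFree Q]
    [Subsingleton (AddUnits Q)] (hdim : AffineAddMonoid.dim Q = 1) :
    primeBound Q = 0 ∧
    (∃! w : GrothendieckAddGroup Q, IsConeGenerator w) ∧
    ∀ w : GrothendieckAddGroup Q, IsConeGenerator w →
      ∀ (k : Type u) [Field k] (p : ℕ) [Fact p.Prime] [CharP k p],
        ∃ ρ : FrobeniusAction (R := AddMonoidAlgebra k Q) p
            (localCohomologyModule (maximalMonomialIdeal k Q) 1),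
          IsNaturalFrobenius p (maximalMonomialIdeal k Q) 1 ρ ∧
          (∀ ρ', IsNaturalFrobenius p (maximalMonomialIdeal k Q) 1 ρ' → ρ' = ρ) ∧
          ∃ e : ℕ,
            IsLeast {e : ℕ | p ^ e • w ∈ Set.range (GrothendieckAddGroup.of (M := Q))} e ∧
            hslNumber ρ = e := by
  obtain ⟨D, hD⟩ := exists_degree Q hdim
  refine ⟨primeBound_eq_zero_of_addEquiv D, ⟨D.symm 1, (isConeGenerator_iff D hD _).2 rfl,
    fun w hw => (isConeGenerator_iff D hD w).1 hw⟩, fun w hw k _ p _ _ => ?_⟩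
  obtain rfl := (isConeGenerator_iff D hD w).1 hw
  obtain ⟨n₀, hn₀⟩ := exists_forall_le_exists_degree_eq D hD
  obtain ⟨v, hv⟩ := hn₀ (n₀ + 1) (by omega)
  have hv' : 0 < D (GrothendieckAddGroup.of v) := by omega
  have hvu : ¬ IsAddUnit v := by
    rintro ⟨a, rfl⟩
    rw [Subsingleton.elim a 0] at hv'
    simp at hv'
  have hI := isRadicalGenerator_single (k := k) D hD hvu
  have hj := isInjectiveLocalization_single (k := k) D hD hv'
  have hbij := localCohomologyComparison_bijective p
    (N := ModuleCat.of (AddMonoidAlgebra k Q) _) hj hI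
  have hρ := isNaturalFrobenius_naturalFrobenius p 1 hbij
  set ρ := naturalFrobenius p 1 hbij
  refine ⟨ρ, hρ, fun ρ' hρ' => hρ.eq_of_injective p hbij.1 hρ', ?_⟩
  have hex : ∃ e : ℕ, p ^ e • D.symm 1 ∈ Set.range (GrothendieckAddGroup.of (M := Q)) := by
    -- As `p ^ n₀ > n₀`, the exponent `n₀` already works.
    obtain ⟨q, hq⟩ := hn₀ (p ^ n₀ : ℕ)
      (by exact_mod_cast (Nat.lt_pow_self (Fact.out (p := p.Prime)).one_lt).le)
    exact ⟨n₀, q, D.injective (by rw [hq, map_nsmul]; simp)⟩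
  classical
  refine ⟨Nat.find hex, ⟨Nat.find_spec hex, fun e he => Nat.find_min' hex he⟩, ?_⟩
  have htf : IsAddTorsionFree (GrothendieckAddGroup Q) :=
    Function.Injective.isAddTorsionFree D.toAddMonoidHom D.injective
  have hpow : ∀ (e : ℕ) (a : AddMonoidAlgebra k (GrothendieckAddGroup Q)),
      ρ^[e] (localizationClass (N := ModuleCat.of (AddMonoidAlgebra k Q) _) hj hI a) =
        localizationClass (N := ModuleCat.of (AddMonoidAlgebra k Q) _) hj hI (a ^ p ^ e) := by
    intro e a
    induction e with
    | zero => simp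
    | succ e ih =>
      rw [Function.iterate_succ_apply', ih, hρ.apply_localizationClass p hj hI, ← pow_mul, pow_succ]
  have hzero := fun e a => (congrArg (· = 0) (hpow e a)).to_iff.trans
    (localizationClass_eq_zero_iff (N := ModuleCat.of (AddMonoidAlgebra k Q) _) hj hI (a ^ p ^ e))
  refine le_antisymm (iInf₂_le_of_le (Nat.find hex) ?_ le_rfl) (le_iInf₂ fun e he => ?_)
  · rintro c ⟨e, hc⟩
    obtain ⟨a, rfl⟩ := localizationClass_surjective
      (N := ModuleCat.of (AddMonoidAlgebra k Q) _) hj hI c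
    have ha := (hzero e a).1 hc
    refine (hzero _ a).2 (pow_char_pow_mem_range p a _ fun m hm => ?_)
    obtain ⟨q, hq⟩ := mem_range_of_mem_range_algebraMap ha (m := p ^ e • m)
      (by rw [coeff_pow_char_pow]; exact pow_ne_zero _ hm)
    -- Nilpotency puts a positive multiple of `m` into `Q`, which forces `m = n • w` with `n ≥ 0`.
    have hm₀ : 0 ≤ D m := by
      have h := hD q
      rw [hq, map_nsmul] at h
      have hp : (0 : ℤ) < (p ^ e : ℕ) := by
        exact_mod_cast pow_pos (Fact.out (p := p.Prime)).pos e
      rw [nsmul_eq_mul] at h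
      exact nonneg_of_mul_nonneg_right h hp
    obtain ⟨n, hn⟩ := Int.eq_ofNat_of_zero_le hm₀
    obtain ⟨r, hr⟩ := Nat.find_spec hex
    refine ⟨n • r, D.injective ?_⟩
    rw [map_nsmul, hr, map_nsmul, map_nsmul, map_nsmul, hn, D.apply_symm_apply]
    simp [mul_comm]
  · refine Nat.cast_le.2 (Nat.find_min' hex ?_)
    -- The lower bound is tested on the class of `x^w`, which is nilpotent because some `p ^ e • w`
    -- lies in `Q`.
    have h₁ := he (localizationClass (N := ModuleCat.of (AddMonoidAlgebra k Q) _) hj hI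
      (AddMonoidAlgebra.single (D.symm 1) 1)) ⟨Nat.find hex, (hzero _ _).2 ?_⟩
    · refine mem_range_of_mem_range_algebraMap ((hzero _ _).1 h₁) ?_
      rw [coeff_pow_char_pow]
      simp
    · refine pow_char_pow_mem_range p _ _ fun m hm => ?_
      obtain rfl : m = D.symm 1 := by
        by_contra hne
        simp [Ne.symm hne] at hm
      exact Nat.find_spec hex
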